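/- \textbf{Theorem.} There is an absolute constant $\kappa>0$ such that for every real $\eta>0$ there is a real $c>0$ with the following property. Let $n\ge 2$ and $\ell$ be integers with $\ell\ge c\cdot\log_2 n$, and let $g:\{0,1\}^\ell\times\{0,1\}^\ell\to\{0,1\}$ be a function with $\mathrm{disc}(g)\le 2^{-\eta\ell}$. Then every function $f:\{0,1\}^n\to\{0,1\}$ satisfies \[ \mathsf{coNP^{cc}}(f\circ g^n)\ \ge\ \kappa\cdot\eta\cdot \mathsf{C}_0(f)\cdot \ell . \] Here the following notions are used. \begin{itemize} \item $(f\circ g^n)(x,y)=f(g(x_1,y_1),\dots,g(x_n,y_n))$ for $x,y\in\{0,1\}^{\ell n}$, viewed as concatenations of $n$ blocks $x_i,y_i\in\{0,1\}^\ell$. \item $\mathrm{disc}(g)$ is the maximum of $\big|\Pr[g(X,Y)=0,\,(X,Y)\in R]-\Pr[g(X,Y)=1,\,(X,Y)\in R]\big|$ over all combinatorial rectangles $R=A\times B$ with $A,B\subseteq\{0,1\}^\ell$, where $X,Y$ are independent and uniform on $\{0,1\}^\ell$. \item $\mathsf{C}_0(f)$ is the smallest $k$ such that the negation $\neg f$ can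 be written as a $k$-DNF formula, that is, as a (possibly empty) disjunction of conjunctions of at most $k$ literals each. \item A non-deterministic protocol is a finite binary tree, each internal node of which is owned by one of the two players. At an internal node its owner sends one bit, chosen non-deterministically from a set of bits that depends only on the node and on the owner's input; at a leaf each of the two players accepts or rejects, depending only on the leaf and on that player's input, and the computation is accepting if both accept. The cost is the depth of the tree. $\mathsf{coNP^{cc}}(F)$ is the smallest cost of a non-deterministic protocol that has an accepting computation on $(x,y)$ if and only if $F(x,y)=0$. (Equivalently, it is $\lceil\log_2 r\rceil$, where $r$ is the least number of combinatorial rectangles whose union is $F^{-1}(0)$, and it is $0$ if $r=0$.) \end{itemize} -/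

import Mathlib

namespace Lifting

/-! ### Non-deterministic communication complexity -/

/-- A two-player non-deterministic protocol, as a binary tree. At an internal node the owner
of the node sends one bit, chosen non-deterministically among the bits that are allowed by the
owner's own input. At a leaf each player accepts or rejects, depending on the player's own
input (and on the leaf, that is, on the bits exchanged so far). -/
inductive NProtocol (X Y : Type) : Type
  | leaf (acceptA : X → Prop) (acceptB : Y → Prop) : NProtocol X Y
  | alice (send : X → Set Bool) (next₀ next₁ : NProtocol X Y) : NProtocol X Y
  | bob (send : Y → Set Bool) (next₀ next₁ : NProtocol X Y) : NProtocol X Y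

namespace NProtocol

variable {X Y : Type}

/-- The worst-case number of communicated bits. -/
def cost : NProtocol X Y → ℕ
  | leaf _ _ => 0
  | alice _ P Q => max P.cost Q.cost + 1
  | bob _ P Q => max P.cost Q.cost + 1

/-- There is an accepting computation on the input `(x, y)`. -/
def Accepts : NProtocol X Y → X → Y → Prop
  | leaf a b, x, y => a x ∧ b y
  | alice s P Q, x, y => (false ∈ s x ∧ P.Accepts x y) ∨ (true ∈ s x ∧ Q.Accepts x y)
  | bob s P Q, x, y => (false ∈ s y ∧ P.Accepts x y) ∨ (true ∈ s y ∧ Q.Accepts x y)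

/-- The protocol is a non-deterministic protocol for `F`. -/
def Computes (P : NProtocol X Y) (F : X → Y → Bool) : Prop :=
  ∀ x y, F x y = true ↔ P.Accepts x y

end NProtocol

/-- Non-deterministic communication complexity: the smallest possible cost of a
non-deterministic protocol for `F`. -/
noncomputable def NPcc {X Y : Type} (F : X → Y → Bool) : ℕ :=
  sInf {t | ∃ P : NProtocol X Y, P.Computes F ∧ P.cost = t}

/-- Co-non-deterministic communication complexity: that of the negation of `F`. -/
noncomputable def coNPcc {X Y : Type} (F : X → Y → Bool) : ℕ :=
  NPcc (fun x y => !(F x y))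

/-! ### Composed functions -/

/-- The function `f ∘ g ^ n`. A vector of `n * ℓ` bits is given as `n` blocks of `ℓ` bits. -/
def compose {n ℓ : ℕ} (f : (Fin n → Bool) → Bool)
    (g : (Fin ℓ → Bool) → (Fin ℓ → Bool) → Bool) :
    (Fin n → Fin ℓ → Bool) → (Fin n → Fin ℓ → Bool) → Bool :=
  fun x y => f (fun i => g (x i) (y i))

/-! ### Certificate complexity -/

/-- A literal: `(i, true)` is the variable `x i` and `(i, false)` is its negation. -/
abbrev Literal (n : ℕ) : Type := Fin n × Bool

/-- A conjunction of literals (the empty one is identically true). -/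
abbrev Conj (n : ℕ) : Type := Finset (Literal n)

/-- The conjunction `C` is satisfied by the assignment `x`. -/
def Conj.Sat {n : ℕ} (C : Conj n) (x : Fin n → Bool) : Prop := ∀ p ∈ C, x p.1 = p.2

/-- A DNF formula: a disjunction of conjunctions (the empty one is identically false). -/
abbrev DNF (n : ℕ) : Type := List (Conj n)

/-- Every conjunction of the formula has at most `k` literals. -/
def DNF.IsKDNF {n : ℕ} (φ : DNF n) (k : ℕ) : Prop := ∀ C ∈ φ, C.card ≤ k

/-- The formula represents the Boolean function `f`. -/
def DNF.Represents {n : ℕ} (φ : DNF n) (f : (Fin n → Bool) → Bool) : Prop :=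
  ∀ x, f x = true ↔ ∃ C ∈ φ, Conj.Sat C x

/-- `1`-certificate complexity: the smallest `k` such that `f` is a `k`-DNF formula. -/
noncomputable def C₁ {n : ℕ} (f : (Fin n → Bool) → Bool) : ℕ :=
  sInf {k | ∃ φ : DNF n, DNF.IsKDNF φ k ∧ DNF.Represents φ f}

/-- `0`-certificate complexity: the `1`-certificate complexity of the negation. -/
noncomputable def C₀ {n : ℕ} (f : (Fin n → Bool) → Bool) : ℕ :=
  C₁ (fun x => !(f x))

/-! ### Discrepancy with respect to the uniform distribution -/

section Discrepancy

variable {Λ : Type} [Fintype Λ]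

open Classical in
/-- The probability of the event `E` for `(X, Y)` uniformly distributed over `Λ × Λ`. -/
noncomputable def prob (E : Set (Λ × Λ)) : ℝ :=
  ((Finset.univ.filter (fun p : Λ × Λ => p ∈ E)).card : ℝ) / (Fintype.card (Λ × Λ) : ℝ)

/-- The discrepancy of `g` on the combinatorial rectangle `A ×ˢ B`. -/
noncomputable def discOn (g : Λ → Λ → Bool) (A B : Finset Λ) : ℝ :=
  |prob {p : Λ × Λ | g p.1 p.2 = false ∧ p.1 ∈ A ∧ p.2 ∈ B} -
    prob {p : Λ × Λ | g p.1 p.2 = true ∧ p.1 ∈ A ∧ p.2 ∈ B}|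

/-- The discrepancy of `g`: the maximum over all combinatorial rectangles. -/
noncomputable def disc (g : Λ → Λ → Bool) : ℝ :=
  (Finset.univ : Finset (Finset Λ × Finset Λ)).sup' Finset.univ_nonempty
    (fun R => discOn g R.1 R.2)

end Discrepancy

end Lifting

namespace Lifting

/-! Fix `z` with `f z = false`. A protocol of cost `t` covers the zeros of `f ∘ g ^ n` by at most `T
= 2 ^ t` rectangles containing no other inputs, so one of them, `A₀ ×ˢ B₀`, contains a `1 / T`
fraction of the preimage of `z`. It suffices that `g ^ n` takes on it every value `z'` agreeing with
`z` on some set `I` of size at most `32 t / (η ℓ)`: then `I` is a certificate for `f z = false`.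

Let `N = 2 ^ ℓ`, `q = 2 ^ (η ℓ / 16)` and `W = N / q`. Among the subrectangles whose two sides are
each constant on the blocks in `I`, take one maximizing `edges ^ 2 * W ^ (2|I|) / (|A||B|)`.
Maximality forces its fibres over free blocks to be small (`IsExtremal.card_fiber_le`); small fibres
leave the nonempty parities too small to cancel the constant Fourier term, so all values occur off
`I` (`exists_of_fiber_le`). On `I` the value is that of `z`, since an edge survives. Comparing the
maximum with `A₀ ×ˢ B₀`, and bounding the edges above by `edges_le_of_constOn`, gives `√q ^ |I| ≤
T`.

Both estimates rest on `abs_corr_le`: discrepancy bounds the box norm of `(-1) ^ g`, the box norm is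
multiplicative over blocks, and it controls bilinear forms. -/

/-- The sign `(-1) ^ b` of a bit. -/
noncomputable def sgn (b : Bool) : ℝ := if b then -1 else 1

lemma indicator_eq (b c : Bool) :
    (if b = c then (1 : ℝ) else 0) = (1 + sgn c * sgn b) / 2 := by
  cases b <;> cases c <;> norm_num [sgn]

/-! ### The box norm. -/

/-- The sum of `K` over all combinatorial `2 × 2` boxes: the fourth power of the box norm. -/
noncomputable def boxSum {X Y : Type*} [Fintype X] [Fintype Y] (K : X → Y → ℝ) : ℝ :=
  ∑ y, ∑ y', (∑ x, K x y * K x y') ^ 2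

lemma boxSum_eq {X Y : Type*} [Fintype X] [Fintype Y] (K : X → Y → ℝ) :
    boxSum K = ∑ y, ∑ y', ∑ x, ∑ x', K x y * K x y' * (K x' y * K x' y') := by
  simp only [boxSum, sq, Finset.sum_mul_sum]

/-- Cauchy–Schwarz twice: first in `x`, eliminating `u`, then over the pairs `(y, y')` obtained by
expanding the square, eliminating `v`. -/
lemma bilinear_pow_four_le {X Y : Type*} [Fintype X] [Fintype Y] (K : X → Y → ℝ)
    (u : X → ℝ) (v : Y → ℝ) :
    (∑ x, ∑ y, u x * v y * K x y) ^ 4 ≤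
      (∑ x, u x ^ 2) ^ 2 * (∑ y, v y ^ 2) ^ 2 * boxSum K := by
  have h1 : (∑ x, ∑ y, u x * v y * K x y) ^ 2 ≤
      (∑ x, u x ^ 2) * ∑ x, (∑ y, v y * K x y) ^ 2 := by
    have := Finset.sum_mul_sq_le_sq_mul_sq Finset.univ u (fun x => ∑ y, v y * K x y)
    simpa only [Finset.mul_sum, mul_assoc] using this
  have h2 : ∑ x, (∑ y, v y * K x y) ^ 2 =
      ∑ p : Y × Y, (v p.1 * v p.2) * ∑ x, K x p.1 * K x p.2 := by
    rw [Fintype.sum_prod_type]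
    have : ∀ x, (∑ y, v y * K x y) ^ 2 = ∑ y, ∑ y', v y * v y' * (K x y * K x y') := by
      intro x
      rw [sq, Finset.sum_mul_sum]
      exact Finset.sum_congr rfl fun y _ => Finset.sum_congr rfl fun y' _ => by ring
    simp only [this, Finset.mul_sum]
    rw [Finset.sum_comm]
    exact Finset.sum_congr rfl fun y _ => Finset.sum_comm
  have h3 := Finset.sum_mul_sq_le_sq_mul_sq Finset.univ (fun p : Y × Y => v p.1 * v p.2)
    (fun p => ∑ x, K x p.1 * K x p.2)
  have h4 : ∑ p : Y × Y, (v p.1 * v p.2) ^ 2 = (∑ y, v y ^ 2) ^ 2 := by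
    rw [sq, Finset.sum_mul_sum, Fintype.sum_prod_type]
    simp only [mul_pow]
  have h5 : ∑ p : Y × Y, (∑ x, K x p.1 * K x p.2) ^ 2 = boxSum K := by
    rw [boxSum, Fintype.sum_prod_type]
  rw [h4, h5, ← h2] at h3
  calc (∑ x, ∑ y, u x * v y * K x y) ^ 4 = ((∑ x, ∑ y, u x * v y * K x y) ^ 2) ^ 2 := by ring
    _ ≤ ((∑ x, u x ^ 2) * ∑ x, (∑ y, v y * K x y) ^ 2) ^ 2 := by gcongr
    _ = (∑ x, u x ^ 2) ^ 2 * (∑ x, (∑ y, v y * K x y) ^ 2) ^ 2 := by ring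
    _ ≤ (∑ x, u x ^ 2) ^ 2 * ((∑ y, v y ^ 2) ^ 2 * boxSum K) := by gcongr
    _ = _ := by ring

/-- A box in the power is an independent choice of a box in each coordinate, so the fourfold sum
factors. -/
lemma boxSum_prod {ι X : Type*} [Fintype ι] [DecidableEq ι] [Fintype X] (K : X → X → ℝ) :
    boxSum (fun x y : ι → X => ∏ i, K (x i) (y i)) = boxSum K ^ Fintype.card ι := by
  have key : ∀ F : ι → X → ℝ, ∑ x : ι → X, ∏ i, F i (x i) = ∏ i, ∑ a, F i a := by
    intro F
    rw [Finset.prod_univ_sum, Fintype.piFinset_univ]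
  rw [boxSum_eq, boxSum_eq]
  simp only [← Finset.prod_mul_distrib]
  have e1 : ∀ y y' x : ι → X,
      ∑ x' : ι → X, ∏ i, K (x i) (y i) * K (x i) (y' i) * (K (x' i) (y i) * K (x' i) (y' i)) =
      ∏ i, ∑ a, K (x i) (y i) * K (x i) (y' i) * (K a (y i) * K a (y' i)) := fun y y' x =>
    key fun i a => K (x i) (y i) * K (x i) (y' i) * (K a (y i) * K a (y' i))
  have e2 : ∀ y y' : ι → X,
      ∑ x : ι → X, ∏ i, ∑ a, K (x i) (y i) * K (x i) (y' i) * (K a (y i) * K a (y' i)) =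
      ∏ i, ∑ b, ∑ a, K b (y i) * K b (y' i) * (K a (y i) * K a (y' i)) := fun y y' =>
    key fun i b => ∑ a, K b (y i) * K b (y' i) * (K a (y i) * K a (y' i))
  have e3 : ∀ y : ι → X,
      ∑ y' : ι → X, ∏ i, ∑ b, ∑ a, K b (y i) * K b (y' i) * (K a (y i) * K a (y' i)) =
      ∏ i, ∑ c, ∑ b, ∑ a, K b (y i) * K b c * (K a (y i) * K a c) := fun y =>
    key fun i c => ∑ b, ∑ a, K b (y i) * K b c * (K a (y i) * K a c)
  have e4 := key fun _ e => ∑ c, ∑ b, ∑ a, K b e * K b c * (K a e * K a c)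
  simp only [e1, e2, e3, e4, Finset.prod_const, Finset.card_univ]

/-! ### Discrepancy controls the box norm. -/

section Discrepancy

variable {Λ : Type} [Fintype Λ] [DecidableEq Λ]

lemma abs_sum_sgn_le (g : Λ → Λ → Bool) (A B : Finset Λ) :
    |∑ x ∈ A, ∑ y ∈ B, sgn (g x y)| ≤ (Fintype.card Λ : ℝ) ^ 2 * disc g := by
  classical
  rcases isEmpty_or_nonempty Λ with h | h
  · simp [Finset.eq_empty_of_isEmpty A]
  have h1 : discOn g A B ≤ disc g :=
    Finset.le_sup' (f := fun R : Finset Λ × Finset Λ => discOn g R.1 R.2) (Finset.mem_univ (A, B))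
  have hN : (0 : ℝ) < Fintype.card Λ := by exact_mod_cast Fintype.card_pos
  have h2 : |∑ x ∈ A, ∑ y ∈ B, sgn (g x y)| = (Fintype.card Λ : ℝ) ^ 2 * discOn g A B := by
    rw [discOn, prob, prob, ← sub_div, abs_div, Fintype.card_prod, Nat.cast_mul, ← sq,
      abs_of_pos (by positivity : (0 : ℝ) < (Fintype.card Λ : ℝ) ^ 2),
      mul_div_cancel₀ _ (by positivity)]
    congr 1
    rw [← Finset.sum_product', Finset.card_filter, Finset.card_filter]
    push_cast
    rw [← Finset.sum_sub_distrib, ← Finset.sum_subset (Finset.subset_univ (A ×ˢ B))]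
    · refine Finset.sum_congr rfl fun p hp => ?_
      have hp := Finset.mem_product.1 hp
      by_cases hg : g p.1 p.2 = true <;> simp [hp.1, hp.2, sgn, hg]
    · intro p _ hp
      rw [Finset.mem_product] at hp
      have : ∀ P : Prop, ¬ (P ∧ p.1 ∈ A ∧ p.2 ∈ B) := fun P h => hp h.2
      simp [this]
  rw [h2]
  gcongr

/-- The level sets of `u` and `v` cut the square into four rectangles with constant sign, hence the
factor 4. -/
lemma abs_sum_signed_le (g : Λ → Λ → Bool) (u v : Λ → Bool) :
    |∑ x, ∑ y, sgn (u x) * sgn (v y) * sgn (g x y)| ≤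
      4 * ((Fintype.card Λ : ℝ) ^ 2 * disc g) := by
  classical
  set U : Bool → Finset Λ := fun b => Finset.univ.filter fun x => u x = b
  set V : Bool → Finset Λ := fun b => Finset.univ.filter fun x => v x = b
  have hsplit : ∀ (w : Λ → Bool) (F : Λ → ℝ), ∑ x, sgn (w x) * F x =
      ∑ x ∈ Finset.univ.filter (fun x => w x = false), F x -
      ∑ x ∈ Finset.univ.filter (fun x => w x = true), F x := by
    intro w F
    rw [Finset.sum_filter, Finset.sum_filter, ← Finset.sum_sub_distrib]
    refine Finset.sum_congr rfl fun x _ => ?_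
    cases h : w x <;> simp [sgn]
  have : ∑ x, ∑ y, sgn (u x) * sgn (v y) * sgn (g x y) =
      (∑ x ∈ U false, ∑ y ∈ V false, sgn (g x y) - ∑ x ∈ U false, ∑ y ∈ V true, sgn (g x y)) -
      (∑ x ∈ U true, ∑ y ∈ V false, sgn (g x y) - ∑ x ∈ U true, ∑ y ∈ V true, sgn (g x y)) := by
    simp only [mul_assoc, ← Finset.mul_sum]
    rw [hsplit u]
    simp only [hsplit v, Finset.sum_sub_distrib, U, V]
  rw [this]
  have h1 := abs_le.1 (abs_sum_sgn_le g (U false) (V false))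
  have h2 := abs_le.1 (abs_sum_sgn_le g (U false) (V true))
  have h3 := abs_le.1 (abs_sum_sgn_le g (U true) (V false))
  have h4 := abs_le.1 (abs_sum_sgn_le g (U true) (V true))
  rw [abs_le]
  constructor <;> linarith [h1.1, h1.2, h2.1, h2.2, h3.1, h3.2, h4.1, h4.2]

/-- With one corner `(x', y')` of the box fixed, the two adjacent corners act as sign vectors in `x`
and `y`, so the inner sum is a signed sum of `g`. -/
lemma boxSum_sgn_le (g : Λ → Λ → Bool) :
    boxSum (fun x y => sgn (g x y)) ≤ 4 * (Fintype.card Λ : ℝ) ^ 4 * disc g := by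
  have e : boxSum (fun x y => sgn (g x y)) = ∑ y', ∑ x',
      sgn (g x' y') * ∑ x, ∑ y, sgn (g x y') * sgn (g x' y) * sgn (g x y) := by
    rw [boxSum_eq, Finset.sum_comm]
    refine Finset.sum_congr rfl fun y' _ => ?_
    simp only [Finset.mul_sum]
    calc _ = ∑ y, ∑ x', ∑ x, _ := Finset.sum_congr rfl fun y _ => Finset.sum_comm
      _ = ∑ x', ∑ y, ∑ x, _ := Finset.sum_comm
      _ = ∑ x', ∑ x, ∑ y, _ := Finset.sum_congr rfl fun x' _ => Finset.sum_comm
      _ = _ := Finset.sum_congr rfl fun x' _ => Finset.sum_congr rfl fun x _ =>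
        Finset.sum_congr rfl fun y _ => by ring
  have hs : ∀ b, |sgn b| = 1 := by intro b; cases b <;> simp [sgn]
  have hle : ∀ y' x', sgn (g x' y') * ∑ x, ∑ y, sgn (g x y') * sgn (g x' y) * sgn (g x y) ≤
      4 * ((Fintype.card Λ : ℝ) ^ 2 * disc g) := by
    intro y' x'
    refine (le_abs_self _).trans ?_
    rw [abs_mul, hs, one_mul]
    exact abs_sum_signed_le g (fun x => g x y') (fun y => g x' y)
  rw [e]
  calc _ ≤ ∑ _y' : Λ, ∑ _x' : Λ, 4 * ((Fintype.card Λ : ℝ) ^ 2 * disc g) :=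
        Finset.sum_le_sum fun y' _ => Finset.sum_le_sum fun x' _ => hle y' x'
    _ = _ := by
        simp only [Finset.sum_const, Finset.card_univ, nsmul_eq_mul]
        ring

end Discrepancy

/-! ### Fourier expansion and correlation of parities with rectangles. -/

section Fourier

variable {Λ : Type} {n : ℕ}

/-- The correlation of the parity of the `g`-values in `S` with the rectangle `A ×ˢ B`. -/
noncomputable def corr (g : Λ → Λ → Bool) (A B : Finset (Fin n → Λ)) (S : Finset (Fin n)) : ℝ :=
  ∑ x ∈ A, ∑ y ∈ B, ∏ i ∈ S, sgn (g (x i) (y i))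

/-- The number of pairs in `A ×ˢ B` on which `g ^ n` takes the value `z`. -/
noncomputable def edges (g : Λ → Λ → Bool) (z : Fin n → Bool) (A B : Finset (Fin n → Λ)) : ℝ :=
  ∑ x ∈ A, ∑ y ∈ B, if (fun i => g (x i) (y i)) = z then 1 else 0

lemma sum_indicator_eq (g : Λ → Λ → Bool) (z : Fin n → Bool) (A B : Finset (Fin n → Λ))
    (T : Finset (Fin n)) :
    ∑ x ∈ A, ∑ y ∈ B, ∏ i ∈ T, (if g (x i) (y i) = z i then (1 : ℝ) else 0) =
      (1 / 2) ^ T.card * ∑ S ∈ T.powerset, (∏ i ∈ S, sgn (z i)) * corr g A B S := by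
  have : ∀ x y : Fin n → Λ, ∏ i ∈ T, (if g (x i) (y i) = z i then (1 : ℝ) else 0) =
      (1 / 2) ^ T.card * ∑ S ∈ T.powerset,
        (∏ i ∈ S, sgn (z i)) * ∏ i ∈ S, sgn (g (x i) (y i)) := by
    intro x y
    simp only [indicator_eq, ← Finset.prod_mul_distrib]
    rw [← Finset.prod_one_add, ← Finset.prod_const, ← Finset.prod_mul_distrib]
    exact Finset.prod_congr rfl fun i _ => by ring
  simp only [this, corr, ← Finset.mul_sum]
  congr 1
  simp only [Finset.mul_sum]
  calc _ = ∑ x ∈ A, ∑ S ∈ T.powerset, ∑ y ∈ B, _ :=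
        Finset.sum_congr rfl fun x _ => Finset.sum_comm
    _ = _ := Finset.sum_comm

lemma abs_prod_sgn (S : Finset (Fin n)) (z : Fin n → Bool) : |∏ i ∈ S, sgn (z i)| = 1 := by
  rw [Finset.abs_prod]
  refine Finset.prod_eq_one fun i _ => ?_
  cases z i <;> simp [sgn]

lemma sum_card_fiber_sq_le {X Y : Type*} [Fintype Y] [DecidableEq Y] (A : Finset X) (φ : X → Y)
    {a : ℝ} (ha : ∀ α, ((A.filter fun x => φ x = α).card : ℝ) ≤ a) :
    ∑ α, ((A.filter fun x => φ x = α).card : ℝ) ^ 2 ≤ a * A.card := by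
  have h : (A.card : ℝ) = ∑ α, ((A.filter fun x => φ x = α).card : ℝ) := by
    exact_mod_cast Finset.card_eq_sum_card_fiberwise (f := φ) (t := Finset.univ) (by simp)
  rw [h, Finset.mul_sum]
  refine Finset.sum_le_sum fun α _ => ?_
  rw [sq]
  exact mul_le_mul_of_nonneg_right (ha α) (by positivity)

variable [Fintype Λ] [DecidableEq Λ]

/-- Grouping by the restriction to `S` turns the correlation into a bilinear form in the fibre
sizes, with a tensor power as kernel. The `ℓ²` norms of the fibre sizes are controlled by the
largest fibre, the kernel by `boxSum_prod`. -/
lemma abs_corr_le (g : Λ → Λ → Bool) (A B : Finset (Fin n → Λ)) (S : Finset (Fin n)) {a b d : ℝ}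
    (hd : 0 ≤ d) (hg : boxSum (fun x y => sgn (g x y)) ≤ d ^ 4)
    (ha : ∀ α : S → Λ, ((A.filter fun x => S.restrict x = α).card : ℝ) ≤ a)
    (hb : ∀ β : S → Λ, ((B.filter fun y => S.restrict y = β).card : ℝ) ≤ b) :
    |corr g A B S| ≤ √(a * A.card) * √(b * B.card) * d ^ S.card := by
  set K : (S → Λ) → (S → Λ) → ℝ := fun α β => ∏ i, sgn (g (α i) (β i))
  set P : (S → Λ) → ℝ := fun α => ((A.filter fun x => S.restrict x = α).card : ℝ)
  set Q : (S → Λ) → ℝ := fun β => ((B.filter fun y => S.restrict y = β).card : ℝ)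
  have hK : ∀ x y : Fin n → Λ,
      ∏ i ∈ S, sgn (g (x i) (y i)) = K (S.restrict x) (S.restrict y) := fun x y =>
    (Finset.prod_coe_sort S fun i => sgn (g (x i) (y i))).symm
  have hfib : ∀ (C : Finset (Fin n → Λ)) (F : (S → Λ) → ℝ), ∑ x ∈ C, F (S.restrict x) =
      ∑ α, ((C.filter fun x => S.restrict x = α).card : ℝ) * F α := by
    intro C F
    rw [← Finset.sum_fiberwise C (fun x => S.restrict x)]
    refine Finset.sum_congr rfl fun α _ => ?_
    rw [← nsmul_eq_mul, ← Finset.sum_const]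
    exact Finset.sum_congr rfl fun x hx => by rw [(Finset.mem_filter.1 hx).2]
  have e : corr g A B S = ∑ α, ∑ β, P α * Q β * K α β := by
    simp only [corr, hK]
    rw [hfib A (fun α => ∑ y ∈ B, K α (S.restrict y))]
    refine Finset.sum_congr rfl fun α _ => ?_
    rw [hfib B (fun β => K α β), Finset.mul_sum]
    exact Finset.sum_congr rfl fun β _ => by ring
  have hbox : boxSum K ≤ (d ^ S.card) ^ 4 := by
    rw [boxSum_prod (ι := S) (fun x y => sgn (g x y)), Fintype.card_coe, ← pow_mul, mul_comm,
      pow_mul]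
    refine pow_le_pow_left₀ ?_ hg _
    exact Finset.sum_nonneg fun _ _ => Finset.sum_nonneg fun _ _ => sq_nonneg _
  have hP : ∑ α, P α ^ 2 ≤ a * A.card := sum_card_fiber_sq_le A _ ha
  have hQ : ∑ β, Q β ^ 2 ≤ b * B.card := sum_card_fiber_sq_le B _ hb
  have hP0 : 0 ≤ ∑ α, P α ^ 2 := Finset.sum_nonneg fun _ _ => sq_nonneg _
  have hQ0 : 0 ≤ ∑ β, Q β ^ 2 := Finset.sum_nonneg fun _ _ => sq_nonneg _
  have hA : 0 ≤ a * A.card := hP0.trans hP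
  have hB : 0 ≤ b * B.card := hQ0.trans hQ
  clear_value K P Q
  have h4 : |corr g A B S| ^ 4 ≤ (√(a * A.card) * √(b * B.card) * d ^ S.card) ^ 4 := by
    have e4 : ∀ r : ℝ, 0 ≤ r → √r ^ 4 = r ^ 2 := fun r hr => by
      rw [show 4 = 2 * 2 from rfl, pow_mul, Real.sq_sqrt hr]
    rw [Even.pow_abs (by decide), mul_pow, mul_pow, e4 _ hA, e4 _ hB, e]
    refine (bilinear_pow_four_le K P Q).trans ?_
    have hbox0 : 0 ≤ boxSum K :=
      Finset.sum_nonneg fun _ _ => Finset.sum_nonneg fun _ _ => sq_nonneg _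
    exact mul_le_mul (mul_le_mul (pow_le_pow_left₀ hP0 hP 2) (pow_le_pow_left₀ hQ0 hQ 2)
      (sq_nonneg _) (sq_nonneg _)) hbox hbox0 (by positivity)
  exact le_of_pow_le_pow_left₀ (by norm_num) (by positivity) h4

end Fourier

/-! ### Edge counts in rectangles: an upper bound and surjectivity. -/

section Rectangles

variable {Λ : Type} {n : ℕ}

lemma edges_le_prod (g : Λ → Λ → Bool) (z : Fin n → Bool) (A B : Finset (Fin n → Λ))
    (T : Finset (Fin n)) :
    edges g z A B ≤
      ∑ x ∈ A, ∑ y ∈ B, ∏ i ∈ T, (if g (x i) (y i) = z i then (1 : ℝ) else 0) := by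
  refine Finset.sum_le_sum fun x _ => Finset.sum_le_sum fun y _ => ?_
  split_ifs with h
  · subst h; simp
  · exact Finset.prod_nonneg fun i _ => by split_ifs <;> norm_num

lemma edges_nonneg (g : Λ → Λ → Bool) (z : Fin n → Bool) (A B : Finset (Fin n → Λ)) :
    0 ≤ edges g z A B :=
  Finset.sum_nonneg fun x _ => Finset.sum_nonneg fun y _ => by split_ifs <;> norm_num

/-- All elements of `A` agree on the coordinates in `I`. -/
def ConstOn (I : Finset (Fin n)) (A : Finset (Fin n → Λ)) : Prop :=
  ∀ x ∈ A, ∀ x' ∈ A, ∀ i ∈ I, x i = x' i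

variable [Fintype Λ] [DecidableEq Λ]

lemma card_fiber_le {I : Finset (Fin n)} {A : Finset (Fin n → Λ)} (hA : ConstOn I A)
    {S : Finset (Fin n)} (hS : S ⊆ Iᶜ) (α : S → Λ) :
    ((A.filter fun x => S.restrict x = α).card : ℝ) ≤
      (Fintype.card Λ : ℝ) ^ (Iᶜ.card - S.card) := by
  rw [← Finset.card_sdiff_of_subset hS]
  have := Finset.card_le_card_of_injOn (s := A.filter fun x => S.restrict x = α)
    (t := (Finset.univ : Finset (↥(Iᶜ \ S) → Λ))) (fun x => (Iᶜ \ S).restrict x)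
    (fun _ _ => Finset.mem_coe.2 (Finset.mem_univ _)) (by
      intro x hx y hy hxy
      simp only [Finset.coe_filter, Set.mem_ofPred_eq] at hx hy
      funext i
      by_cases hi : i ∈ I
      · exact hA x hx.1 y hy.1 i hi
      by_cases hi' : i ∈ S
      · exact congrFun (hx.2.trans hy.2.symm) ⟨i, hi'⟩
      · exact congrFun hxy ⟨i, by simp [hi, hi']⟩)
  rw [Finset.card_univ, Fintype.card_fun, Fintype.card_coe] at this
  exact_mod_cast this

/-- Expand the indicator over the free blocks, bound each parity, and resum by the binomial theorem.
The size enters as `√(|A||B|)`, which is what cancels the area in the extremal ratio. -/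
lemma edges_le_of_constOn (g : Λ → Λ → Bool) (z : Fin n → Bool) {A B : Finset (Fin n → Λ)}
    {I : Finset (Fin n)} (hA : ConstOn I A) (hB : ConstOn I B) {d : ℝ}
    (hd : 0 ≤ d) (hg : boxSum (fun x y => sgn (g x y)) ≤ d ^ 4) :
    edges g z A B ≤ √A.card * √B.card * (((Fintype.card Λ : ℝ) + d) / 2) ^ Iᶜ.card := by
  set N : ℝ := ((Fintype.card Λ : ℕ) : ℝ) with hN
  have hN0 : 0 ≤ N := by positivity
  have hS : ∀ S ∈ Iᶜ.powerset, (∏ i ∈ S, sgn (z i)) * corr g A B S ≤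
      √A.card * √B.card * (d ^ S.card * N ^ (Iᶜ.card - S.card)) := by
    intro S hS
    rw [Finset.mem_powerset] at hS
    refine (le_abs_self _).trans ?_
    rw [abs_mul, abs_prod_sgn, one_mul]
    refine (abs_corr_le g A B S hd hg (card_fiber_le hA hS) (card_fiber_le hB hS)).trans
      (le_of_eq ?_)
    rw [← hN]
    set M := N ^ (Iᶜ.card - S.card)
    have hM : 0 ≤ M := by positivity
    rw [Real.sqrt_mul hM, Real.sqrt_mul hM]
    linear_combination √A.card * √B.card * d ^ S.card * Real.mul_self_sqrt hM
  refine (edges_le_prod g z A B Iᶜ).trans ?_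
  rw [sum_indicator_eq]
  refine (mul_le_mul_of_nonneg_left (Finset.sum_le_sum hS) (by positivity)).trans (le_of_eq ?_)
  rw [← Finset.mul_sum, add_comm N d, Finset.sum_pow_mul_eq_add_pow, div_eq_mul_one_div (d + N),
    mul_pow]
  ring

/-- If all fibres are small then every value of `g ^ n` outside `I` occurs. -/
lemma exists_of_fiber_le (g : Λ → Λ → Bool) (z : Fin n → Bool) {A B : Finset (Fin n → Λ)}
    {I : Finset (Fin n)} {d r : ℝ} (hd : 0 ≤ d) (hr : 0 ≤ r)
    (hg : boxSum (fun x y => sgn (g x y)) ≤ d ^ 4)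
    (hA0 : A.Nonempty) (hB0 : B.Nonempty)
    (hA : ∀ S ⊆ Iᶜ, ∀ α : S → Λ,
      ((A.filter fun x => S.restrict x = α).card : ℝ) ≤ 4 * r ^ S.card * A.card)
    (hB : ∀ S ⊆ Iᶜ, ∀ β : S → Λ,
      ((B.filter fun y => S.restrict y = β).card : ℝ) ≤ 4 * r ^ S.card * B.card)
    (hn : 8 * n * (r * d) ≤ 1) :
    ∃ x ∈ A, ∃ y ∈ B, ∀ i ∉ I, g (x i) (y i) = z i := by
  by_contra! hcon
  have hA' : (0 : ℝ) < A.card := by exact_mod_cast hA0.card_pos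
  have hB' : (0 : ℝ) < B.card := by exact_mod_cast hB0.card_pos
  have hzero : ∑ x ∈ A, ∑ y ∈ B, ∏ i ∈ Iᶜ, (if g (x i) (y i) = z i then (1 : ℝ) else 0) = 0 := by
    refine Finset.sum_eq_zero fun x hx => Finset.sum_eq_zero fun y hy => ?_
    obtain ⟨i, hi, h⟩ := hcon x hx y hy
    exact Finset.prod_eq_zero (Finset.mem_compl.2 hi) (if_neg h)
  rw [sum_indicator_eq, mul_eq_zero, or_iff_right (by positivity)] at hzero
  set ρ : ℝ := 4 * (r * d) with hρ
  have hρ0 : 0 ≤ ρ := by positivity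
  have hS : ∀ S ∈ Iᶜ.powerset.erase ∅, - ((∏ i ∈ S, sgn (z i)) * corr g A B S) ≤
      A.card * B.card * ρ ^ S.card := by
    intro S hS
    rw [Finset.mem_erase, Finset.mem_powerset] at hS
    refine (neg_le_abs _).trans ?_
    rw [abs_mul, abs_prod_sgn, one_mul]
    refine (abs_corr_le g A B S hd hg (hA S hS.2) (hB S hS.2)).trans ?_
    have hM : 0 ≤ 4 * r ^ S.card := by positivity
    rw [mul_assoc _ (A.card : ℝ), mul_assoc _ (B.card : ℝ), Real.sqrt_mul hM, Real.sqrt_mul hM,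
      Real.sqrt_mul_self hA'.le, Real.sqrt_mul_self hB'.le]
    -- As `S` is nonempty, the constant 4 of the fibre bound is absorbed into `ρ ^ S.card`.
    have h4 : (4 : ℝ) ≤ 4 ^ S.card :=
      le_self_pow₀ (by norm_num) (Finset.card_ne_zero.2 (Finset.nonempty_iff_ne_empty.2 hS.1))
    calc √(4 * r ^ S.card) * A.card * (√(4 * r ^ S.card) * B.card) * d ^ S.card
        = (A.card * B.card * r ^ S.card * d ^ S.card) * 4 := by
          linear_combination A.card * B.card * d ^ S.card * Real.mul_self_sqrt hM
      _ ≤ (A.card * B.card * r ^ S.card * d ^ S.card) * 4 ^ S.card := by gcongr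
      _ = _ := by rw [hρ, mul_pow, mul_pow]; ring
  have hsum := Finset.sum_le_sum hS
  rw [Finset.sum_neg_distrib, ← Finset.mul_sum] at hsum
  have hempty : ∅ ∈ Iᶜ.powerset := Finset.empty_mem_powerset _
  rw [← Finset.add_sum_erase _ _ hempty] at hzero
  have hc : corr g A B ∅ = A.card * B.card := by simp [corr]
  have hpow : ∑ S ∈ Iᶜ.powerset, ρ ^ S.card = (ρ + 1) ^ Iᶜ.card := by
    rw [← Finset.sum_pow_mul_eq_add_pow]; simp
  rw [← Finset.add_sum_erase _ _ hempty] at hpow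
  simp only [Finset.prod_empty, hc, one_mul, Finset.card_empty, pow_zero] at hzero hpow
  -- The nonempty parities total at most `(ρ + 1) ^ Iᶜ.card - 1` times the area; below 1, they
  -- cannot cancel the constant term.
  have hlt : (ρ + 1) ^ Iᶜ.card < 2 := by
    have hcard : (Iᶜ.card : ℝ) ≤ n := by
      have := Finset.card_le_univ Iᶜ
      rw [Fintype.card_fin] at this
      exact_mod_cast this
    calc (ρ + 1) ^ Iᶜ.card ≤ Real.exp ρ ^ Iᶜ.card := by
          gcongr; exact Real.add_one_le_exp ρ
      _ = Real.exp (Iᶜ.card * ρ) := (Real.exp_nat_mul _ _).symm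
      _ ≤ Real.exp (1 / 2) := by
          gcongr
          calc (Iᶜ.card : ℝ) * ρ ≤ n * ρ := by gcongr
            _ ≤ 1 / 2 := by rw [hρ]; linarith
      _ < 2 := by
          rw [← Real.lt_log_iff_exp_lt (by norm_num)]
          linarith [Real.log_two_gt_d9]
  have hAB := mul_pos hA' hB'
  nlinarith

end Rectangles

/-! ### Extremal rectangles. -/

section Extremal

variable {Λ : Type} {n : ℕ}

lemma edges_flip (g : Λ → Λ → Bool) (z : Fin n → Bool) (A B : Finset (Fin n → Λ)) :
    edges (flip g) z B A = edges g z A B := Finset.sum_comm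

lemma edges_of_not_nonempty (g : Λ → Λ → Bool) (z : Fin n → Bool) {A B : Finset (Fin n → Λ)}
    (h : ¬ (A.Nonempty ∧ B.Nonempty)) : edges g z A B = 0 := by
  simp only [not_and_or, Finset.not_nonempty_iff_eq_empty] at h
  rcases h with rfl | rfl <;> simp [edges]

/-- No rectangle inside `A ×ˢ B` with more fixed coordinates beats `A ×ˢ B` in the ratio
of `edges ^ 2` to area, when each fixed coordinate is rewarded by `W ^ 2`. -/
def IsExtremal (g : Λ → Λ → Bool) (z : Fin n → Bool) (W : ℝ) (I : Finset (Fin n))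
    (A B : Finset (Fin n → Λ)) : Prop :=
  ∀ I' A' B', A' ⊆ A → B' ⊆ B → ConstOn I' A' → ConstOn I' B' →
    edges g z A' B' ^ 2 * (W ^ I'.card) ^ 2 * (A.card * B.card) ≤
      edges g z A B ^ 2 * (W ^ I.card) ^ 2 * (A'.card * B'.card)

lemma IsExtremal.flip {g : Λ → Λ → Bool} {z : Fin n → Bool} {W : ℝ} {I : Finset (Fin n)}
    {A B : Finset (Fin n → Λ)} (h : IsExtremal g z W I A B) :
    IsExtremal (flip g) z W I B A := by
  intro I' B' A' hB hA hB' hA'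
  have := h I' A' B' hA hB hA' hB'
  rw [edges_flip, edges_flip]
  linarith

variable [DecidableEq Λ]

lemma ConstOn.filter_restrict {I : Finset (Fin n)} {A : Finset (Fin n → Λ)} (hA : ConstOn I A)
    (S : Finset (Fin n)) (α : S → Λ) :
    ConstOn (I ∪ S) (A.filter fun x => S.restrict x = α) := by
  intro x hx y hy i hi
  rw [Finset.mem_filter] at hx hy
  rcases Finset.mem_union.1 hi with hi | hi
  · exact hA x hx.1 y hy.1 i hi
  · exact congrFun (hx.2.trans hy.2.symm) ⟨i, hi⟩

variable [Fintype Λ]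

/-- There are finitely many candidates, and `(∅, A₀, B₀)` is one with positive ratio, so a maximizer
has an edge. The last inequality is the comparison with that candidate. -/
lemma exists_isExtremal (g : Λ → Λ → Bool) (z : Fin n → Bool) {W : ℝ} (hW : 0 < W)
    {A₀ B₀ : Finset (Fin n → Λ)} (h : 0 < edges g z A₀ B₀) :
    ∃ I, ∃ A ⊆ A₀, ∃ B ⊆ B₀, ConstOn I A ∧ ConstOn I B ∧ 0 < edges g z A B ∧
      IsExtremal g z W I A B ∧
      edges g z A₀ B₀ ^ 2 * (A.card * B.card) ≤
        edges g z A B ^ 2 * (W ^ I.card) ^ 2 * (A₀.card * B₀.card) := by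
  classical
  set Φ : Finset (Fin n) × Finset (Fin n → Λ) × Finset (Fin n → Λ) → ℝ := fun p =>
    edges g z p.2.1 p.2.2 ^ 2 * (W ^ p.1.card) ^ 2 / (p.2.1.card * p.2.2.card) with hΦ
  have hpos : ∀ {A B : Finset (Fin n → Λ)}, A.Nonempty ∧ B.Nonempty →
      (0 : ℝ) < A.card * B.card := fun hn =>
    mul_pos (by exact_mod_cast hn.1.card_pos) (by exact_mod_cast hn.2.card_pos)
  have hne : ∀ {A B : Finset (Fin n → Λ)}, edges g z A B ≠ 0 → A.Nonempty ∧ B.Nonempty :=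
    fun hh => by_contra fun hn => hh (edges_of_not_nonempty g z hn)
  have h₀ : (∅, A₀, B₀) ∈ Finset.univ.filter
      (fun p : Finset (Fin n) × Finset (Fin n → Λ) × Finset (Fin n → Λ) =>
        p.2.1 ⊆ A₀ ∧ p.2.2 ⊆ B₀ ∧ ConstOn p.1 p.2.1 ∧ ConstOn p.1 p.2.2) :=
    Finset.mem_filter.2 ⟨Finset.mem_univ _, subset_rfl, subset_rfl, by simp [ConstOn],
      by simp [ConstOn]⟩
  obtain ⟨⟨I, A, B⟩, hm, hmax⟩ := Finset.exists_max_image _ Φ ⟨_, h₀⟩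
  obtain ⟨hA, hB, hIA, hIB⟩ := (Finset.mem_filter.1 hm).2
  have hpos₀ : 0 < Φ (∅, A₀, B₀) := by
    have := hpos (hne h.ne')
    simp only [hΦ]
    positivity
  have hΦpos : 0 < Φ (I, A, B) := hpos₀.trans_le (hmax _ h₀)
  have he : edges g z A B ≠ 0 := by
    intro h0
    simp [hΦ, h0] at hΦpos
  have hcross : ∀ I' A' B', A' ⊆ A₀ → B' ⊆ B₀ → ConstOn I' A' → ConstOn I' B' →
      edges g z A' B' ^ 2 * (W ^ I'.card) ^ 2 * (A.card * B.card) ≤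
        edges g z A B ^ 2 * (W ^ I.card) ^ 2 * (A'.card * B'.card) := by
    intro I' A' B' hA' hB' hIA' hIB'
    by_cases hn : A'.Nonempty ∧ B'.Nonempty
    · have := hmax (I', A', B') (Finset.mem_filter.2 ⟨Finset.mem_univ _, hA', hB', hIA', hIB'⟩)
      exact (div_le_div_iff₀ (hpos hn) (hpos (hne he))).1 this
    · rw [edges_of_not_nonempty g z hn]
      simp only [ne_eq, OfNat.ofNat_ne_zero, not_false_eq_true, zero_pow, zero_mul]
      positivity
  refine ⟨I, A, hA, B, hB, hIA, hIB, (edges_nonneg g z A B).lt_of_ne' he, ?_, ?_⟩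
  · exact fun I' A' B' hA' hB' => hcross I' A' B' (hA'.trans hA) (hB'.trans hB)
  · simpa using hcross ∅ A₀ B₀ subset_rfl subset_rfl (by simp [ConstOn]) (by simp [ConstOn])

/-- Deleting a fibre must not raise the ratio, so the fibre carries at least half its share of
edges. Fixing `S` on the `B` side too must not raise it either, so no pair of fibres has too many
edges. Summing over the fibres of `B` makes the two bounds compete. -/
lemma IsExtremal.card_fiber_le {g : Λ → Λ → Bool} {z : Fin n → Bool} {W : ℝ} (hW : 0 < W)
    {I : Finset (Fin n)} {A B : Finset (Fin n → Λ)} (h : IsExtremal g z W I A B)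
    (hA : ConstOn I A) (hB : ConstOn I B) (he : 0 < edges g z A B)
    {S : Finset (Fin n)} (hS : S ⊆ Iᶜ) (α : S → Λ) :
    ((A.filter fun x => S.restrict x = α).card : ℝ) ≤
      4 * ((Fintype.card Λ : ℝ) / W ^ 2) ^ S.card * A.card := by
  set Aα := A.filter fun x => S.restrict x = α with hAα
  set Bf : (S → Λ) → Finset (Fin n → Λ) := fun β => B.filter fun y => S.restrict y = β with hBf
  have hne : A.Nonempty ∧ B.Nonempty :=
    by_contra fun hn => he.ne' (edges_of_not_nonempty g z hn)
  have ha : (0 : ℝ) < A.card := by exact_mod_cast hne.1.card_pos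
  have hb : (0 : ℝ) < B.card := by exact_mod_cast hne.2.card_pos
  have hsub : Aα ⊆ A := Finset.filter_subset _ _
  set e := edges g z A B
  set d := edges g z Aα B with hd
  have hWI : 0 < W ^ I.card := pow_pos hW _
  have hWS : 0 < W ^ S.card := pow_pos hW _
  -- Expand `(e - d) ^ 2 * |A| ≤ e ^ 2 * (|A| - |Aα|)` and drop `d ^ 2 * |A|`.
  have hremove : e * Aα.card ≤ 2 * d * A.card := by
    have h1 := h I (A \ Aα) B Finset.sdiff_subset subset_rfl
      (fun x hx y hy => hA x (Finset.sdiff_subset hx) y (Finset.sdiff_subset hy)) hB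
    have h2 : edges g z (A \ Aα) B = e - d := by
      rw [eq_sub_iff_add_eq]
      exact Finset.sum_sdiff hsub
    have h3 : ((A \ Aα).card : ℝ) = A.card - Aα.card := by
      rw [Finset.card_sdiff_of_subset hsub, Nat.cast_sub (Finset.card_le_card hsub)]
    rw [h2, h3] at h1
    have h4 : (e - d) ^ 2 * A.card ≤ e ^ 2 * (A.card - Aα.card) := by
      refine le_of_mul_le_mul_right ?_ (by positivity : 0 < (W ^ I.card) ^ 2 * (B.card : ℝ))
      linarith
    refine le_of_mul_le_mul_left ?_ he
    nlinarith [mul_nonneg (sq_nonneg d) ha.le]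
  have hβ : ∀ β, edges g z Aα (Bf β) ^ 2 * ((W ^ S.card) ^ 2 * (A.card * B.card)) ≤
      e ^ 2 * Aα.card * (Bf β).card := by
    intro β
    have h1 := h (I ∪ S) Aα (Bf β) hsub (Finset.filter_subset _ _)
      (hA.filter_restrict S α) (hB.filter_restrict S β)
    rw [Finset.card_union_of_disjoint (Finset.disjoint_left.2 fun i hi hi' =>
      Finset.mem_compl.1 (hS hi') hi), pow_add] at h1
    refine le_of_mul_le_mul_right ?_ (by positivity : 0 < (W ^ I.card) ^ 2)
    linarith
  have hdsum : d = ∑ β, edges g z Aα (Bf β) := by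
    rw [hd]
    simp only [edges]
    rw [Finset.sum_comm (s := Finset.univ)]
    exact Finset.sum_congr rfl fun x _ =>
      (Finset.sum_fiberwise B (fun y => S.restrict y) _).symm
  have hBsum : (B.card : ℝ) = ∑ β, ((Bf β).card : ℝ) := by
    exact_mod_cast Finset.card_eq_sum_card_fiberwise (f := fun y => S.restrict y)
      (t := Finset.univ) (by simp)
  -- Cauchy–Schwarz over the `N ^ |S|` values of `β`: the source of the numerator in `N / W ^ 2`.
  have hcs : d ^ 2 ≤ (Fintype.card Λ : ℝ) ^ S.card * ∑ β, edges g z Aα (Bf β) ^ 2 := by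
    have := sq_sum_le_card_mul_sum_sq (s := Finset.univ) (f := fun β => edges g z Aα (Bf β))
    rw [← hdsum, Finset.card_univ, Fintype.card_fun, Fintype.card_coe] at this
    exact_mod_cast this
  have hsum := Finset.sum_le_sum fun β (_ : β ∈ Finset.univ) => hβ β
  rw [← Finset.sum_mul, ← Finset.mul_sum, ← hBsum] at hsum
  set E := ∑ β, edges g z Aα (Bf β) ^ 2
  set NS := (Fintype.card Λ : ℝ) ^ S.card with hNS
  have hNS0 : 0 ≤ NS := by positivity
  rw [div_pow, ← hNS, ← pow_mul, mul_comm 2, pow_mul]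
  set m : ℝ := ((Aα.card : ℕ) : ℝ) with hm
  rcases (Nat.cast_nonneg Aα.card : (0 : ℝ) ≤ m).eq_or_lt with hm0 | hm0
  · rw [hm, ← hm0]; positivity
  have hd2 : (W ^ S.card) ^ 2 * A.card * d ^ 2 ≤ NS * (e ^ 2 * m) := by
    refine le_of_mul_le_mul_right ?_ hb
    calc (W ^ S.card) ^ 2 * A.card * d ^ 2 * B.card
        ≤ (W ^ S.card) ^ 2 * A.card * (NS * E) * B.card := by gcongr
      _ = NS * (E * ((W ^ S.card) ^ 2 * (A.card * B.card))) := by ring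
      _ ≤ NS * (e ^ 2 * m * B.card) := by gcongr
      _ = _ := by ring
  have hsq : (e * m) ^ 2 ≤ (2 * d * A.card) ^ 2 := by gcongr
  rw [mul_div_assoc', div_mul_eq_mul_div, le_div_iff₀ (by positivity)]
  refine le_of_mul_le_mul_right ?_ (by positivity : 0 < e ^ 2 * m)
  calc m * (W ^ S.card) ^ 2 * (e ^ 2 * m) = (W ^ S.card) ^ 2 * (e * m) ^ 2 := by ring
    _ ≤ (W ^ S.card) ^ 2 * (2 * d * A.card) ^ 2 := by gcongr
    _ = 4 * A.card * ((W ^ S.card) ^ 2 * A.card * d ^ 2) := by ring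
    _ ≤ 4 * A.card * (NS * (e ^ 2 * m)) := by gcongr
    _ = _ := by ring

/-- On the full square the blocks are independent, and discrepancy on the whole square bounds the
bias of each. -/
lemma edges_univ_ge (g : Λ → Λ → Bool) (z : Fin n → Bool) (hdisc : disc g ≤ 1) :
    ((Fintype.card Λ : ℝ) ^ 2 * (1 - disc g) / 2) ^ n ≤ edges g z Finset.univ Finset.univ := by
  have e : edges g z Finset.univ Finset.univ =
      ∏ i, ∑ a, ∑ b, (if g a b = z i then (1 : ℝ) else 0) := by
    rw [Finset.prod_univ_sum, Fintype.piFinset_univ, edges]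
    refine Finset.sum_congr rfl fun x _ => ?_
    rw [Finset.prod_univ_sum, Fintype.piFinset_univ]
    refine Finset.sum_congr rfl fun y _ => ?_
    rw [Finset.prod_boole]
    simp [funext_iff]
  rw [e, ← Fin.prod_const]
  refine Finset.prod_le_prod (fun i _ => ?_) fun i _ => ?_
  · have := sub_nonneg.2 hdisc
    positivity
  · have h1 := abs_sum_sgn_le g Finset.univ Finset.univ
    simp only [indicator_eq, ← Finset.sum_div, Finset.sum_add_distrib, ← Finset.mul_sum,
      Finset.sum_const, Finset.card_univ, nsmul_eq_mul, mul_one]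
    have h2 := abs_le.1 h1
    set σ := ∑ x, ∑ y, sgn (g x y)
    rcases z i with _ | _
    · rw [show sgn false = 1 from rfl]; linarith [h2.1]
    · rw [show sgn true = -1 from rfl]; linarith [h2.2]

end Extremal
-- From a dense rectangle to a certificate.
section Certificate

variable {Λ : Type} {n : ℕ} [DecidableEq Λ] [Fintype Λ]

/-- After division by `(N ^ 2 / 2) ^ (k + m)`, each of the `k` fixed blocks contributes `2 / q`,
while the free blocks and the bias `δ` cost only bounded factors. -/
lemma pow_card_le_of_edges_le {N q T δ : ℝ} {k m : ℕ} (hN : 0 < N)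
    (hq : 128 * ((k + m : ℕ) : ℝ) ≤ q)
    (h256 : 256 ≤ q) (hT : 1 ≤ T) (hδ : δ ≤ (q ^ 16)⁻¹)
    (h : (N ^ 2 * (1 - δ) / 2) ^ (k + m) ≤
      T * (N ^ (k + m) * ((N / q) ^ k * ((N + 2 * N / q ^ 4) / 2) ^ m))) :
    √q ^ k ≤ T := by
  have hq0 : 0 < q := by linarith
  have hq1 : 1 ≤ q := by linarith
  -- For `k ≥ 1` the accumulated factor 4 is absorbed into `4 ^ k`; `k = 0` has no room for it.
  rcases Nat.eq_zero_or_pos k with rfl | hk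
  · simpa using hT
  have hq4 : q ≤ q ^ 4 := le_self_pow₀ hq1 (by norm_num)
  have hq16 : q ≤ q ^ 16 := le_self_pow₀ hq1 (by norm_num)
  have hm : (m : ℝ) ≤ ((k + m : ℕ) : ℝ) := by exact_mod_cast Nat.le_add_left m k
  have hn0 : (0 : ℝ) ≤ ((k + m : ℕ) : ℝ) := Nat.cast_nonneg _
  have h1 : 1 / 2 ≤ (1 - δ) ^ (k + m) := by
    have hinv : (q ^ 16)⁻¹ ≤ q⁻¹ := inv_anti₀ hq0 hq16
    have hinv1 : q⁻¹ ≤ 1 := inv_le_one_of_one_le₀ hq1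
    have h2 : ((k + m : ℕ) : ℝ) * δ ≤ 1 / 2 := by
      calc ((k + m : ℕ) : ℝ) * δ ≤ ((k + m : ℕ) : ℝ) * q⁻¹ :=
            mul_le_mul_of_nonneg_left (hδ.trans hinv) hn0
        _ ≤ 1 / 2 := by
            rw [← div_eq_mul_inv, div_le_iff₀ hq0]
            linarith
    have := one_add_mul_le_pow (a := -δ) (by linarith) (k + m)
    rw [← sub_eq_add_neg] at this
    linarith
  have h2 : (1 + 2 / q ^ 4) ^ m ≤ 2 := by
    calc (1 + 2 / q ^ 4) ^ m ≤ Real.exp (2 / q ^ 4) ^ m := by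
          gcongr
          linarith [Real.add_one_le_exp (2 / q ^ 4)]
      _ = Real.exp (m * (2 / q ^ 4)) := (Real.exp_nat_mul _ _).symm
      _ ≤ Real.exp (1 / 2) := by
          gcongr
          rw [mul_div_assoc', div_le_iff₀ (by positivity)]
          linarith
      _ ≤ 2 := by
          rw [← Real.le_log_iff_exp_le (by norm_num)]
          linarith [Real.log_two_gt_d9]
  have h3 : (q / 2) ^ k ≤ 4 * T := by
    have hpos : 0 < (N ^ 2 / 2) ^ (k + m) := by positivity
    have e1 : (N ^ 2 * (1 - δ) / 2) ^ (k + m) = (N ^ 2 / 2) ^ (k + m) * (1 - δ) ^ (k + m) := by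
      rw [← mul_pow]; ring
    have e2 : N ^ (k + m) * ((N / q) ^ k * ((N + 2 * N / q ^ 4) / 2) ^ m) =
        (N ^ 2 / 2) ^ (k + m) * ((2 / q) ^ k * (1 + 2 / q ^ 4) ^ m) := by
      have e3 : N * (N / q) = N ^ 2 / 2 * (2 / q) := by ring
      have e4 : N * ((N + 2 * N / q ^ 4) / 2) = N ^ 2 / 2 * (1 + 2 / q ^ 4) := by ring
      rw [pow_add, pow_add, mul_mul_mul_comm, ← mul_pow, ← mul_pow, e3, e4, mul_pow, mul_pow,
        mul_mul_mul_comm]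
    rw [e1, e2, mul_left_comm] at h
    have h4 := le_of_mul_le_mul_left h hpos
    have h5 : 1 / 2 ≤ T * ((2 / q) ^ k * 2) := by
      refine (h1.trans h4).trans ?_
      gcongr
    have h6 : (2 / q) ^ k * (q / 2) ^ k = 1 := by
      rw [← mul_pow]
      have : 2 / q * (q / 2) = 1 := by field_simp
      rw [this, one_pow]
    calc (q / 2) ^ k = 2 * (1 / 2) * (q / 2) ^ k := by ring
      _ ≤ 2 * (T * ((2 / q) ^ k * 2)) * (q / 2) ^ k := by gcongr
      _ = 4 * T * ((2 / q) ^ k * (q / 2) ^ k) := by ring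
      _ = 4 * T := by rw [h6, mul_one]
  have hs : 4 * √q ≤ q / 2 := by
    have h8 : 8 ≤ √q := Real.le_sqrt_of_sq_le (by linarith)
    nlinarith [Real.mul_self_sqrt hq0.le]
  have h7 : 4 * √q ^ k ≤ 4 * T := by
    refine le_trans ?_ h3
    calc 4 * √q ^ k ≤ 4 ^ k * √q ^ k := by
          gcongr
          exact le_self_pow₀ (by norm_num) hk.ne'
      _ = (4 * √q) ^ k := (mul_pow _ _ _).symm
      _ ≤ (q / 2) ^ k := by gcongr
  linarith

/-- A rectangle that contains a `1 / T` fraction of the preimage of `z` under `g ^ n` meets the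
preimage of every `z'` that agrees with `z` on a certain small set of coordinates. -/
theorem exists_certificate (g : Λ → Λ → Bool) (z : Fin n → Bool) {q T : ℝ}
    (hn : 2 ≤ n) (hq : 128 * (n : ℝ) ≤ q) (hT : 1 ≤ T) (hΛ : 0 < Fintype.card Λ)
    (hdisc : disc g ≤ (q ^ 16)⁻¹) {A₀ B₀ : Finset (Fin n → Λ)}
    (h : edges g z Finset.univ Finset.univ ≤ T * edges g z A₀ B₀) :
    ∃ I : Finset (Fin n), √q ^ I.card ≤ T ∧ ∀ z' : Fin n → Bool, (∀ i ∈ I, z' i = z i) →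
      ∃ x ∈ A₀, ∃ y ∈ B₀, (fun i => g (x i) (y i)) = z' := by
  have hn' : (2 : ℝ) ≤ n := by exact_mod_cast hn
  have h256 : 256 ≤ q := by linarith
  have hq0 : 0 < q := by linarith
  set N : ℝ := ((Fintype.card Λ : ℕ) : ℝ) with hNdef
  have hN : 0 < N := Nat.cast_pos.2 hΛ
  have hdisc1 : disc g < 1 := hdisc.trans_lt (inv_lt_one_of_one_lt₀ (one_lt_pow₀ (by linarith)
    (by norm_num)))
  have hge := edges_univ_ge g z hdisc1.le
  have he₀ : 0 < edges g z A₀ B₀ := by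
    have h1 : 0 < 1 - disc g := sub_pos.2 hdisc1
    have h2 : 0 < T * edges g z A₀ B₀ := lt_of_lt_of_le (by positivity) (hge.trans h)
    exact pos_of_mul_pos_right h2 (by linarith)
  set W : ℝ := N / q with hW
  -- Chosen so that `d ^ 4 = 16 * N ^ 4 / q ^ 16` dominates the box bound, while `N / W ^ 2 * d = 2
  -- / q ^ 2` beats `1 / (8 * n)`.
  set d : ℝ := 2 * N / q ^ 4 with hd
  have hW0 : 0 < W := by positivity
  have hd0 : 0 ≤ d := by positivity
  have hbox : boxSum (fun x y => sgn (g x y)) ≤ d ^ 4 := by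
    refine (boxSum_sgn_le g).trans ?_
    have e : d ^ 4 = 16 * N ^ 4 * (q ^ 16)⁻¹ := by rw [hd]; field_simp; ring
    rw [e]
    have : 0 ≤ N ^ 4 * (q ^ 16)⁻¹ := by positivity
    calc 4 * N ^ 4 * disc g ≤ 4 * N ^ 4 * (q ^ 16)⁻¹ := by gcongr
      _ ≤ _ := by linarith
  obtain ⟨I, A, hA, B, hB, hIA, hIB, he, hext, hcmp⟩ := exists_isExtremal g z hW0 he₀
  have hne : A.Nonempty ∧ B.Nonempty :=
    by_contra fun hn => he.ne' (edges_of_not_nonempty g z hn)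
  refine ⟨I, ?_, ?_⟩
  · have hcard : I.card + Iᶜ.card = n := by rw [Finset.card_add_card_compl, Fintype.card_fin]
    have hle := edges_le_of_constOn g z hIA hIB hd0 hbox
    rw [← hNdef] at hle
    have ha : (0 : ℝ) < A.card := by exact_mod_cast hne.1.card_pos
    have hb : (0 : ℝ) < B.card := by exact_mod_cast hne.2.card_pos
    have hcardle : ∀ C : Finset (Fin n → Λ), (C.card : ℝ) ≤ N ^ n := by
      intro C
      have := Finset.card_le_univ C
      rw [Fintype.card_fun, Fintype.card_fin] at this
      rw [hNdef]
      exact_mod_cast this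
    have h1 : edges g z A₀ B₀ ≤ N ^ n * (W ^ I.card * ((N + d) / 2) ^ Iᶜ.card) := by
      refine le_of_sq_le_sq ?_ (by positivity)
      refine le_of_mul_le_mul_right (hcmp.trans ?_) (mul_pos ha hb)
      calc edges g z A B ^ 2 * (W ^ I.card) ^ 2 * (A₀.card * B₀.card)
          ≤ (√A.card * √B.card * ((N + d) / 2) ^ Iᶜ.card) ^ 2 * (W ^ I.card) ^ 2 *
              (N ^ n * N ^ n) := by
            gcongr
            · exact hcardle A₀
            · exact hcardle B₀
        _ = √A.card ^ 2 * √B.card ^ 2 *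
              (N ^ n * (W ^ I.card * ((N + d) / 2) ^ Iᶜ.card)) ^ 2 := by ring
        _ = _ := by rw [Real.sq_sqrt ha.le, Real.sq_sqrt hb.le]; ring
    refine pow_card_le_of_edges_le (m := Iᶜ.card) (N := N) hN (by rwa [hcard]) h256 hT hdisc ?_
    rw [hcard]
    refine (hge.trans h).trans ?_
    gcongr
  · intro z' hz'
    have hr : N / W ^ 2 * d = 2 / q ^ 2 := by rw [hW, hd]; field_simp
    have hr0 : 0 ≤ N / W ^ 2 := by positivity
    obtain ⟨x, hx, y, hy, hxy⟩ := exists_of_fiber_le g z' (I := I) hd0 hr0 hbox hne.1 hne.2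
      (fun S hS α => hext.card_fiber_le hW0 hIA hIB he hS α)
      (fun S hS β => hext.flip.card_fiber_le hW0 hIB hIA (by rwa [edges_flip]) hS β) (by
        rw [hr, mul_div_assoc', div_le_one (by positivity)]
        nlinarith)
    refine ⟨x, hA hx, y, hB hy, funext fun i => ?_⟩
    by_cases hi : i ∈ I
    -- Any edge `(a, b)` of `A ×ˢ B` has value `z`, and both sides are constant on `I`.
    · obtain ⟨a, ha, hne'⟩ := Finset.exists_ne_zero_of_sum_ne_zero he.ne'
      obtain ⟨b, hb, hne''⟩ := Finset.exists_ne_zero_of_sum_ne_zero hne'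
      have hab : (fun i => g (a i) (b i)) = z := by
        by_contra hab
        exact hne'' (if_neg hab)
      rw [hz' i hi, ← hab, hIA x hx a ha i hi, hIB y hy b hb i hi]
    · exact hxy i hi

end Certificate

/-! ### Protocols, rectangle covers and certificates. -/

namespace NProtocol

variable {X Y : Type}

/-- The accepted inputs of a protocol of cost `t` are a union of at most `2 ^ t` rectangles. -/
lemma exists_rectangles (P : NProtocol X Y) :
    ∃ (ι : Type) (_ : Fintype ι) (A : ι → Set X) (B : ι → Set Y),
      Fintype.card ι ≤ 2 ^ P.cost ∧ ∀ x y, P.Accepts x y ↔ ∃ i, x ∈ A i ∧ y ∈ B i := by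
  have hcard : ∀ {ι κ : Type} [Fintype ι] [Fintype κ] {a b : ℕ}, Fintype.card ι ≤ 2 ^ a →
      Fintype.card κ ≤ 2 ^ b → Fintype.card (ι ⊕ κ) ≤ 2 ^ (max a b + 1) := by
    intro ι κ _ _ a b ha hb
    have h1 := Nat.pow_le_pow_right (n := 2) (by norm_num) (le_max_left a b)
    have h2 := Nat.pow_le_pow_right (n := 2) (by norm_num) (le_max_right a b)
    rw [Fintype.card_sum, pow_succ]
    omega
  induction P with
  | leaf a b => exact ⟨Unit, inferInstance, fun _ => {x | a x}, fun _ => {y | b y}, by simp [cost],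
      fun x y => by simp [Accepts]⟩
  | alice s P Q hP hQ =>
    obtain ⟨ι, _, A, B, hι, h⟩ := hP
    obtain ⟨κ, _, A', B', hκ, h'⟩ := hQ
    refine ⟨ι ⊕ κ, inferInstance,
      Sum.elim (fun i => {x | false ∈ s x ∧ x ∈ A i}) (fun j => {x | true ∈ s x ∧ x ∈ A' j}),
      Sum.elim B B', hcard hι hκ, fun x y => ?_⟩
    simp [Accepts, h, h', and_assoc]
  | bob s P Q hP hQ =>
    obtain ⟨ι, _, A, B, hι, h⟩ := hP
    obtain ⟨κ, _, A', B', hκ, h'⟩ := hQ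
    refine ⟨ι ⊕ κ, inferInstance, Sum.elim A A',
      Sum.elim (fun i => {y | false ∈ s y ∧ y ∈ B i}) (fun j => {y | true ∈ s y ∧ y ∈ B' j}),
      hcard hι hκ, fun x y => ?_⟩
    simp only [Accepts, h, h', Sum.exists, Sum.elim_inl, Sum.elim_inr, Set.mem_ofPred_eq,
      ← exists_and_left]
    exact or_congr (exists_congr fun _ => and_left_comm) (exists_congr fun _ => and_left_comm)

/-- Guess `x` and let the other player verify. This makes the set of costs nonempty, so its `sInf`
is attained rather than a default 0. -/
lemma exists_computes [Finite X] (F : X → Y → Bool) : ∃ P : NProtocol X Y, P.Computes F := by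
  have key : ∀ L : List X, ∃ P : NProtocol X Y, ∀ x y, (x ∈ L ∧ F x y = true) ↔ P.Accepts x y := by
    intro L
    induction L with
    | nil => exact ⟨leaf (fun _ => False) (fun _ => False), by simp [Accepts]⟩
    | cons a L ih =>
      obtain ⟨P, hP⟩ := ih
      refine ⟨alice (fun _ => Set.univ) (leaf (fun x => x = a) (fun y => F a y = true)) P, ?_⟩
      intro x y
      simp only [Accepts, ← hP, List.mem_cons, Set.mem_univ, true_and, or_and_right]
      refine or_congr_left (and_congr_right ?_)
      rintro rfl
      rfl
  have := Fintype.ofFinite X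
  obtain ⟨P, hP⟩ := key Finset.univ.toList
  exact ⟨P, fun x y => by simp [← hP]⟩

end NProtocol

lemma exists_protocol_cost_eq_coNPcc {X Y : Type} [Finite X] (F : X → Y → Bool) :
    ∃ P : NProtocol X Y, (∀ x y, F x y = false ↔ P.Accepts x y) ∧ P.cost = coNPcc F := by
  obtain ⟨P₀, hP₀⟩ := NProtocol.exists_computes fun x y => !(F x y)
  obtain ⟨P, hP, hc⟩ := Nat.sInf_mem
    (s := {t | ∃ P : NProtocol X Y, P.Computes (fun x y => !(F x y)) ∧ P.cost = t})
    ⟨_, P₀, hP₀, rfl⟩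
  exact ⟨P, fun x y => by rw [← hP x y, Bool.not_eq_true'], hc⟩

/-- One of the rectangles covering the preimage of `z` contains a large fraction of it. -/
lemma exists_edges_le {Λ : Type} [Fintype Λ] {n : ℕ} (g : Λ → Λ → Bool)
    (z : Fin n → Bool) {ι : Type} [Fintype ι] (A B : ι → Finset (Fin n → Λ)) {T : ℝ}
    (hcard : (Fintype.card ι : ℝ) ≤ T) (hpos : 0 < edges g z Finset.univ Finset.univ)
    (hcov : ∀ x y, (fun i => g (x i) (y i)) = z → ∃ j, x ∈ A j ∧ y ∈ B j) :
    ∃ j, edges g z Finset.univ Finset.univ ≤ T * edges g z (A j) (B j) := by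
  classical
  by_contra! hcon
  set E := edges g z Finset.univ Finset.univ with hE
  have hle : E ≤ ∑ j, edges g z (A j) (B j) := by
    have h1 : ∀ j, edges g z (A j) (B j) = ∑ x, ∑ y,
        if x ∈ A j ∧ y ∈ B j then (if (fun i => g (x i) (y i)) = z then (1 : ℝ) else 0) else 0 := by
      intro j
      rw [edges, ← Fintype.sum_ite_mem]
      refine Finset.sum_congr rfl fun x _ => ?_
      by_cases hx : x ∈ A j <;> simp [hx, Finset.sum_ite_mem]
    simp only [h1]
    rw [Finset.sum_comm, hE]
    refine Finset.sum_le_sum fun x _ => ?_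
    rw [Finset.sum_comm]
    refine Finset.sum_le_sum fun y _ => ?_
    have hnn : ∀ j ∈ Finset.univ, (0 : ℝ) ≤
        if x ∈ A j ∧ y ∈ B j then (if (fun i => g (x i) (y i)) = z then (1 : ℝ) else 0) else 0 :=
      fun j _ => by split_ifs <;> norm_num
    split_ifs with hz
    · obtain ⟨j, hj⟩ := hcov x y hz
      simp only [hz, if_true] at hnn
      refine le_trans ?_ (Finset.single_le_sum hnn (Finset.mem_univ j))
      rw [if_pos hj]
    · simp
  have hT : 0 ≤ T := (Nat.cast_nonneg _).trans hcard
  rcases isEmpty_or_nonempty ι with hι | hι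
  · simp at hle
    linarith
  have h2 : T * E < T * E := by
    calc T * E ≤ T * ∑ j, edges g z (A j) (B j) := by gcongr
      _ = ∑ j, T * edges g z (A j) (B j) := Finset.mul_sum _ _ _
      _ < ∑ _j : ι, E := Finset.sum_lt_sum_of_nonempty Finset.univ_nonempty fun j _ => hcon j
      _ = Fintype.card ι * E := by simp
      _ ≤ T * E := by gcongr
  exact lt_irrefl _ h2

lemma C₀_le {n k : ℕ} (f : (Fin n → Bool) → Bool)
    (h : ∀ z, f z = false → ∃ I : Finset (Fin n), I.card ≤ k ∧
      ∀ z' : Fin n → Bool, (∀ i ∈ I, z' i = z i) → f z' = false) : C₀ f ≤ k := by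
  classical
  choose! I hI hf using h
  refine Nat.sInf_le ⟨((Finset.univ.filter fun z => f z = false).toList.map fun z =>
    (I z).image fun i => (i, z i)), ?_, ?_⟩
  · intro C hC
    obtain ⟨z, hz, rfl⟩ := List.mem_map.1 hC
    have hz : f z = false := by simpa using hz
    exact Finset.card_image_le.trans (hI z hz)
  · intro x
    simp only [Bool.not_eq_true', List.mem_map, Finset.mem_toList, Finset.mem_filter,
      Finset.mem_univ, true_and, Conj.Sat]
    constructor
    · exact fun hx => ⟨_, ⟨x, hx, rfl⟩, by simp⟩
    · rintro ⟨_, ⟨z, hz, rfl⟩, hs⟩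
      exact hf z hz x fun i hi => hs (i, z i) (Finset.mem_image_of_mem _ hi)

end Lifting

/-! ### The lifting theorem: choice of parameters. -/

theorem mainTheorem3 :
    ∃ κ : ℝ, 0 < κ ∧
      ∀ η : ℝ, 0 < η → ∃ c : ℝ, 0 < c ∧
        ∀ ℓ n : ℕ, 2 ≤ n → c * Real.logb 2 (n : ℝ) ≤ (ℓ : ℝ) →
          ∀ g : (Fin ℓ → Bool) → (Fin ℓ → Bool) → Bool,
            Lifting.disc g ≤ (2 : ℝ) ^ (-(η * (ℓ : ℝ))) →
              ∀ f : (Fin n → Bool) → Bool,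
                κ * (η * (Lifting.C₀ f : ℝ) * (ℓ : ℝ)) ≤
                  (Lifting.coNPcc (Lifting.compose f g) : ℝ) := by
  classical
  -- Discrepancy `q ^ (-16)` gives `q = 2 ^ (η ℓ / 16)`, and the square root in `√q ^ |I| ≤ 2 ^ t`
  -- turns 16 into 32. With `c = 128 / η`, `η ℓ / 16 ≥ 8 log n ≥ 7 + log n` (logarithms to base 2),
  -- so `q ≥ 128 n`.
  refine ⟨1 / 32, by norm_num, fun η hη => ⟨128 / η, by positivity, ?_⟩⟩
  intro ℓ n hn hℓ g hg f
  have hn' : (2 : ℝ) ≤ n := by exact_mod_cast hn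
  have hlog : 1 ≤ Real.logb 2 n := by
    rw [Real.le_logb_iff_rpow_le (by norm_num) (by linarith)]
    simpa using hn'
  have hηℓ : 128 * Real.logb 2 n ≤ η * ℓ := by
    rw [div_mul_eq_mul_div, div_le_iff₀ hη] at hℓ
    linarith
  have hηℓ0 : 0 < η * ℓ := by linarith
  set q : ℝ := 2 ^ (η * ℓ / 16) with hq
  have hqn : 128 * (n : ℝ) ≤ q := by
    calc 128 * (n : ℝ) = 2 ^ (7 + Real.logb 2 n) := by
          rw [Real.rpow_add (by norm_num), Real.rpow_logb (by norm_num) (by norm_num)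
            (by linarith)]
          norm_num
      _ ≤ q := Real.rpow_le_rpow_of_exponent_le (by norm_num) (by linarith)
  have hq16 : (q ^ 16)⁻¹ = (2 : ℝ) ^ (-(η * ℓ)) := by
    rw [hq, ← Real.rpow_natCast, ← Real.rpow_mul (by norm_num), Real.rpow_neg (by norm_num)]
    congr 2
    push_cast
    ring
  rw [← hq16] at hg
  have hsqrt : ∀ k : ℕ, √q ^ k = (2 : ℝ) ^ (η * ℓ / 32 * k) := by
    intro k
    rw [hq, Real.sqrt_eq_rpow, ← Real.rpow_mul (by norm_num), ← Real.rpow_natCast,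
      ← Real.rpow_mul (by norm_num)]
    congr 1
    ring
  obtain ⟨P, hP, hcost⟩ := Lifting.exists_protocol_cost_eq_coNPcc (Lifting.compose f g)
  obtain ⟨ι, _, A, B, hcard, hAB⟩ := P.exists_rectangles
  rw [← hcost]
  set t := P.cost
  have hk : Lifting.C₀ f ≤ ⌊32 * (t : ℝ) / (η * ℓ)⌋₊ := by
    refine Lifting.C₀_le f fun z hz => ?_
    have hΛ : 0 < Fintype.card (Fin ℓ → Bool) := Fintype.card_pos
    have hdisc1 : Lifting.disc g < 1 := hg.trans_lt (inv_lt_one_of_one_lt₀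
      (one_lt_pow₀ (by linarith) (by norm_num)))
    have hpos : 0 < Lifting.edges g z Finset.univ Finset.univ := by
      have := sub_pos.2 hdisc1
      refine lt_of_lt_of_le ?_ (Lifting.edges_univ_ge g z hdisc1.le)
      positivity
    obtain ⟨j, hj⟩ := Lifting.exists_edges_le g z (fun j => Finset.univ.filter fun x => x ∈ A j)
      (fun j => Finset.univ.filter fun y => y ∈ B j) (T := 2 ^ t) (by exact_mod_cast hcard) hpos
      (by
        intro x y hxy
        have : Lifting.compose f g x y = false := by
          rw [Lifting.compose, hxy, hz]
        simpa using (hAB x y).1 ((hP x y).1 this))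
    obtain ⟨I, hI, hcert⟩ := Lifting.exists_certificate g z hn hqn (one_le_pow₀ (by norm_num)) hΛ
      hg hj
    refine ⟨I, ?_, fun z' hz' => ?_⟩
    · rw [hsqrt, ← Real.rpow_natCast, Real.rpow_le_rpow_left_iff (by norm_num)] at hI
      refine Nat.le_floor ?_
      rw [le_div_iff₀ hηℓ0]
      linarith
    · obtain ⟨x, hx, y, hy, hxy⟩ := hcert z' hz'
      have := (hP x y).2 ((hAB x y).2 ⟨j, by simpa using hx, by simpa using hy⟩)
      rwa [Lifting.compose, hxy] at this
  have hk' : (Lifting.C₀ f : ℝ) ≤ 32 * (t : ℝ) / (η * ℓ) :=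
    (Nat.cast_le.2 hk).trans (Nat.floor_le (by positivity))
  rw [le_div_iff₀ hηℓ0] at hk'
  linarith
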